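/- Let $n\ge 0$ be an integer, let $\mathbb{B}_n=\{z\in\mathbb{C}^n:|z|<1\}$ be the open unit ball for the Hermitian norm, and let $v$ be Lebesgue measure on $\mathbb{B}_n$ divided by the volume of $\mathbb{B}_n$. Let $L^2_a(\mathbb{B}_n)$ be the Bergman space, that is, the space of holomorphic functions $f$ on $\mathbb{B}_n$ with $\|f\|^2=\int_{\mathbb{B}_n}|f|^2\,dv<\infty$. For a polynomial $p\in\mathbb{C}[z_1,\dots,z_n]$ let $[p]$ be the closed submodule of $L^2_a(\mathbb{B}_n)$ generated by $p$, that is, the closure in $L^2_a(\mathbb{B}_n)$ of the ideal $p\,\mathbb{C}[z_1,\dots,z_n]$. Then, for every $p\in\mathbb{C}[z_1,\dots,z_n]$ and every $f\in L^2_a(\mathbb{B}_n)$, one has $f\in[p]$ if and only if there is a holomorphic function $h$ on $\mathbb{B}_n$ such that $f(z)=p(z)h(z)$ for all $z\in\mathbb{B}_n$. -/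

import Mathlib

open MeasureTheory

noncomputable section

namespace Bergman

/-- The space `ℂⁿ` with its Hermitian norm `|z|² = ∑ |zᵢ|²`. -/
abbrev Cn (n : ℕ) : Type := EuclideanSpace ℂ (Fin n)

/-- The open unit ball `{z ∈ ℂⁿ : |z| < 1}`. -/
def unitBall (n : ℕ) : Set (Cn n) := Metric.ball 0 1

/-- Normalized Lebesgue measure on the unit ball. -/
def ballMeasure (n : ℕ) : Measure (Cn n) :=
  (volume (unitBall n))⁻¹ • (volume : Measure (Cn n)).restrict (unitBall n)

/-- The Bergman space of the unit ball: the classes in `L²` of the ball that have a holomorphic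
representative, with the norm and topology of `L²`. -/
def bergmanSpace (n : ℕ) : Submodule ℂ (Lp ℂ 2 (ballMeasure n)) where
  carrier := {F | ∃ f : Cn n → ℂ, DifferentiableOn ℂ f (unitBall n) ∧ F =ᵐ[ballMeasure n] f}
  zero_mem' := ⟨0, differentiableOn_const 0, Lp.coeFn_zero ℂ 2 (ballMeasure n)⟩
  add_mem' := by
    rintro F G ⟨f, hf, hF⟩ ⟨g, hg, hG⟩
    exact ⟨f + g, hf.add hg, (Lp.coeFn_add F G).trans (hF.add hG)⟩
  smul_mem' := by
    rintro c F ⟨f, hf, hF⟩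
    exact ⟨c • f, hf.const_smul c, (Lp.coeFn_smul c F).trans (hF.const_smul c)⟩

/-- The element of the Bergman space given by a square integrable function that is holomorphic
on the ball. -/
def ofFun {n : ℕ} (f : Cn n → ℂ) (hf : DifferentiableOn ℂ f (unitBall n))
    (hf2 : MemLp f 2 (ballMeasure n)) : bergmanSpace n :=
  ⟨hf2.toLp f, f, hf, hf2.coeFn_toLp⟩

/-- The function `z ↦ p(z)` on `ℂⁿ` of a polynomial `p ∈ ℂ[z₁, …, zₙ]`. -/
def polyFun {n : ℕ} (p : MvPolynomial (Fin n) ℂ) : Cn n → ℂ :=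
  fun z => MvPolynomial.eval (fun i => z i) p

theorem differentiable_polyFun {n : ℕ} (p : MvPolynomial (Fin n) ℂ) :
    Differentiable ℂ (polyFun p) := by
  induction p using MvPolynomial.induction_on with
  | C a =>
    have h : polyFun (n := n) (MvPolynomial.C a) = fun _ => a := by funext z; simp [polyFun]
    rw [h]
    exact differentiable_const a
  | add p q hp hq =>
    have h : polyFun (p + q) = polyFun p + polyFun q := by funext z; simp [polyFun]
    rw [h]
    exact hp.add hq
  | mul_X p i hp =>
    have h : polyFun (p * MvPolynomial.X i) = polyFun p * fun z => z i := by
      funext z; simp [polyFun]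
    have hi : Differentiable ℂ (fun z : Cn n => z i) := by fun_prop
    rw [h]
    exact hp.mul hi

theorem memLp_polyFun {n : ℕ} (p : MvPolynomial (Fin n) ℂ) :
    MemLp (polyFun p) 2 (ballMeasure n) := by
  have hpos : volume (unitBall n) ≠ 0 := (Metric.measure_ball_pos volume 0 one_pos).ne'
  refine MemLp.smul_measure ?_ (ENNReal.inv_ne_top.2 hpos)
  have : IsFiniteMeasure ((volume : Measure (Cn n)).restrict (unitBall n)) :=
    ⟨by simpa [unitBall] using (measure_ball_lt_top : volume (Metric.ball (0 : Cn n) 1) < _)⟩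
  have hc := (differentiable_polyFun p).continuous
  obtain ⟨C, hC⟩ := (isCompact_closedBall (0 : Cn n) 1).exists_bound_of_continuousOn
    hc.continuousOn
  refine MemLp.of_bound hc.aestronglyMeasurable C ?_
  exact (ae_restrict_iff' Metric.isOpen_ball.measurableSet).2
    (Filter.Eventually.of_forall fun z hz => hC z (Metric.ball_subset_closedBall hz))

/-- The inclusion of the polynomials `ℂ[z₁, …, zₙ]` into the Bergman space. -/
def ofPoly (n : ℕ) : MvPolynomial (Fin n) ℂ →ₗ[ℂ] bergmanSpace n where
  toFun p := ofFun (polyFun p) (differentiable_polyFun p).differentiableOn (memLp_polyFun p)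
  map_add' p q := by
    apply Subtype.ext
    change (memLp_polyFun (p + q)).toLp _ =
      (memLp_polyFun p).toLp _ + (memLp_polyFun q).toLp _
    rw [← MemLp.toLp_add]
    congr 1
    funext z
    simp [polyFun]
  map_smul' c p := by
    apply Subtype.ext
    change (memLp_polyFun (c • p)).toLp _ = c • (memLp_polyFun p).toLp _
    rw [← MemLp.toLp_const_smul]
    congr 1
    funext z
    simp [polyFun, MvPolynomial.smul_eval]

/-- The closed submodule `[p]` of the Bergman space generated by the polynomial `p`: the closure
in the Bergman space of the principal ideal `p ℂ[z₁, …, zₙ]`. -/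
def principalSubmodule {n : ℕ} (p : MvPolynomial (Fin n) ℂ) : Submodule ℂ (bergmanSpace n) :=
  (((Ideal.span {p}).restrictScalars ℂ).map (ofPoly n)).topologicalClosure

end Bergman

end

/-!
The theorem says that a function `f` in the Bergman space lies in the closure `[p]` of the ideal
generated by a polynomial `p` exactly when `p` divides `f` among the holomorphic functions on the
ball. For `p = 0` both conditions say `f = 0`; let `p ≠ 0`.

*From `[p]` to a holomorphic quotient.* By the mean value property, convergence in the Bergman
space implies uniform convergence on compact subsets (`tendstoUniformlyOn_of_tendsto_eLpNorm`). So
if `p q_k → f` in `L²`, then `p q_k → f` locally uniformly. Near a given point choose a small circle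
in a complex line on which `p` has no zero; the mean value property expresses `q_k` near the point
by the values of `(p q_k) / p` on translates of that circle. Hence `q_k` converges near the point
to the circle mean of `f / p`, which depends holomorphically on the point
(`exists_tendsto_differentiableAt`), and the limit `h` satisfies `f = p h`.

*From a holomorphic quotient to `[p]`.* Let `f = p h` and `h_r(z) = h(r z)` with `r < 1`. On the
closed ball `h_r` is a uniform limit of polynomials (`exists_polyFun_approx`), so `p h_r ∈ [p]`, and
it suffices that `p h_r → p h` in `L²` as `r → 1`. The point is the one-variable inequality
`∫ |P(ζ) F(rζ)|² ≤ 4 ^ N ∫ |P(ζ) F(ζ)|²` over the unit circle, for a polynomial `P` of degree at most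
`N` and `F` holomorphic near the closed disc (`integral_circle_poly_mul_le`). To see it, reflect the
roots of `P` inside the disc in the circle: this gives `Q` with `|Q| = |P|` on the circle and
`|P(ζ)| ≤ 2 ^ N |Q(rζ)|` there, because `|ζ - a| ≤ 2 |rζ - a|` when `|a| ≥ 1`; then use that the
quadratic mean of the holomorphic function `Q F` increases with the radius. Applied to the slices
`P(ζ) = p(ζz)`, of degree at most that of `p`, and `F(ζ) = h(ζz)`, the inequality bounds the circle
means of `|p h_r - p h|²` by a multiple of those of `|p h|²`. The latter are integrable, since
Lebesgue measure is invariant under `z ↦ e^{iθ} z`, and dominated convergence applies.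
-/

namespace Bergman

open Metric Filter Topology ComplexConjugate
open scoped ENNReal

/-! ### Holomorphic functions on finite-dimensional spaces -/

theorem deriv_comp_line {E : Type*} [NormedAddCommGroup E] [NormedSpace ℂ E] {f : E → ℂ} {z : E}
    (hf : DifferentiableAt ℂ f z) (v : E) :
    deriv (fun t : ℂ => f (z + t • v)) 0 = fderiv ℂ f z v := by
  have hline : HasDerivAt (fun t : ℂ => z + t • v) v 0 := by
    simpa using ((hasDerivAt_id (0 : ℂ)).smul_const v).const_add z
  have h0 : HasFDerivAt f (fderiv ℂ f z) (z + (0 : ℂ) • v) := by simpa using hf.hasFDerivAt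
  exact (h0.comp_hasDerivAt (0 : ℂ) hline).deriv

/-- Cauchy estimate for the derivative, from the one-variable estimate on complex lines. -/
theorem norm_fderiv_le_of_closedBall {E : Type*} [NormedAddCommGroup E] [NormedSpace ℂ E]
    {f : E → ℂ} {z : E} {R M : ℝ} (hR : 0 < R)
    (hf : ∀ w ∈ closedBall z R, DifferentiableAt ℂ f w)
    (hM : ∀ w ∈ closedBall z R, ‖f w‖ ≤ M) : ‖fderiv ℂ f z‖ ≤ M / R := by
  have hM0 : 0 ≤ M := (norm_nonneg _).trans (hM z (mem_closedBall_self hR.le))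
  refine ContinuousLinearMap.opNorm_le_bound _ (by positivity) fun v => ?_
  rcases eq_or_ne v 0 with rfl | hv
  · simp
  have hv' : 0 < ‖v‖ := norm_pos_iff.2 hv
  have hmem : ∀ t ∈ closedBall (0 : ℂ) (R / ‖v‖), z + t • v ∈ closedBall z R := by
    intro t ht
    rw [mem_closedBall_zero_iff, le_div_iff₀ hv'] at ht
    simpa [norm_smul] using ht
  have hline : Differentiable ℂ fun t : ℂ => z + t • v := by fun_prop
  have hd : ∀ t ∈ closedBall (0 : ℂ) (R / ‖v‖),
      DifferentiableAt ℂ (fun t : ℂ => f (z + t • v)) t := fun t ht =>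
    (hf _ (hmem t ht)).comp t (hline t)
  have hdc : DiffContOnCl ℂ (fun t : ℂ => f (z + t • v)) (ball 0 (R / ‖v‖)) := by
    refine DifferentiableOn.diffContOnCl fun t ht => ?_
    exact (hd t (closure_ball_subset_closedBall ht)).differentiableWithinAt
  have := Complex.norm_deriv_le_of_forall_mem_sphere_norm_le (by positivity) hdc
    fun t ht => hM _ (hmem t (sphere_subset_closedBall ht))
  rw [deriv_comp_line (hf z (mem_closedBall_self hR.le))] at this
  exact this.trans_eq (by field_simp)

/-- An integral of a holomorphic function over a family of affine reparametrizations is holomorphic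
in the parameter. Circle means, directional Cauchy integrals and inner products on a circle are all
of this form. -/
theorem differentiableOn_integral_comp {E : Type*} [NormedAddCommGroup E] [NormedSpace ℂ E]
    [FiniteDimensional ℂ E] [MeasurableSpace E] [BorelSpace E] {U V : Set E} (hU : IsOpen U)
    (hV : IsOpen V) {f : E → ℂ} (hf : DifferentiableOn ℂ f U) {c a : ℝ → ℂ} {b : ℝ → E}
    (hc : Continuous c) (ha : Continuous a) (hb : Continuous b)
    (hmaps : ∀ z ∈ V, ∀ θ, a θ • z + b θ ∈ U) (s t : ℝ) :
    DifferentiableOn ℂ (fun z => ∫ θ in s..t, c θ * f (a θ • z + b θ)) V := by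
  have : ProperSpace E := FiniteDimensional.proper ℂ E
  have : SecondCountableTopology (E →L[ℂ] ℂ) :=
    have := FiniteDimensional.proper ℂ (E →L[ℂ] ℂ)
    inferInstance
  intro z₀ hz₀
  obtain ⟨R, hR, hRV⟩ : ∃ R > 0, closedBall z₀ R ⊆ V :=
    nhds_basis_closedBall.mem_iff.1 (hV.mem_nhds hz₀)
  have hjoint : ContinuousOn (fun q : ℝ × E => c q.1 * f (a q.1 • q.2 + b q.1))
      (Set.uIcc s t ×ˢ closedBall z₀ R) := by
    refine (hc.comp continuous_fst).continuousOn.mul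
      (hf.continuousOn.comp (by fun_prop) ?_)
    rintro ⟨θ, z⟩ ⟨-, hz⟩
    exact hmaps z (hRV hz) θ
  obtain ⟨M, hM⟩ := (isCompact_uIcc.prod (isCompact_closedBall z₀ R)).exists_bound_of_continuousOn
    hjoint
  have hcont : ∀ z ∈ V, Continuous fun θ => c θ * f (a θ • z + b θ) := fun z hz =>
    hc.mul (hf.continuousOn.comp_continuous (by fun_prop) (hmaps z hz))
  have hdiff : ∀ θ, ∀ z ∈ V, HasFDerivAt (fun z => c θ * f (a θ • z + b θ))
      ((c θ * a θ) • fderiv ℂ f (a θ • z + b θ)) z := by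
    intro θ z hz
    have h1 : HasFDerivAt (fun z : E => a θ • z + b θ) (a θ • ContinuousLinearMap.id ℂ E) z :=
      ((hasFDerivAt_id z).const_smul (a θ)).add_const (b θ)
    have h2 := ((hf.differentiableAt (hU.mem_nhds (hmaps z hz θ))).hasFDerivAt.comp z h1).const_mul
      (c θ)
    refine h2.congr_fderiv ?_
    ext v
    simp [mul_assoc]
  have hball : ∀ z ∈ ball z₀ (R / 2), closedBall z (R / 2) ⊆ closedBall z₀ R := by
    intro z hz
    refine closedBall_subset_closedBall' ?_
    rw [mem_ball] at hz
    linarith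
  refine (intervalIntegral.hasFDerivAt_integral_of_dominated_of_fderiv_le
    (F' := fun z θ => (c θ * a θ) • fderiv ℂ f (a θ • z + b θ)) (bound := fun _ => M / (R / 2))
    (ball_mem_nhds z₀ (half_pos hR)) ?_ ((hcont z₀ hz₀).intervalIntegrable s t) ?_
    (.of_forall fun θ hθ z hz => ?_) (by simp) (.of_forall fun θ hθ z hz => hdiff θ z
      (hRV (hball z hz
        (mem_closedBall_self (half_pos hR).le))))).differentiableAt.differentiableWithinAt
  · filter_upwards [hV.mem_nhds hz₀] with z hz using (hcont z hz).aestronglyMeasurable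
  · refine AEStronglyMeasurable.smul (hc.mul ha).aestronglyMeasurable ?_
    exact ((measurable_fderiv ℂ f).comp (by fun_prop)).aestronglyMeasurable
  · rw [← (hdiff θ z (hRV (hball z hz (mem_closedBall_self (half_pos hR).le)))).fderiv]
    refine norm_fderiv_le_of_closedBall (half_pos hR)
      (fun w hw => (hdiff θ w (hRV (hball z hz hw))).differentiableAt) fun w hw => ?_
    exact hM (θ, w) ⟨Set.uIoc_subset_uIcc hθ, hball z hz hw⟩

/-- The directional derivatives of a holomorphic function are holomorphic, being Cauchy integrals
over circles in the given direction. -/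
theorem differentiableOn_fderiv_apply {E : Type*} [NormedAddCommGroup E] [NormedSpace ℂ E]
    [FiniteDimensional ℂ E] [MeasurableSpace E] [BorelSpace E] {U : Set E} (hU : IsOpen U)
    {f : E → ℂ} (hf : DifferentiableOn ℂ f U) (v : E) :
    DifferentiableOn ℂ (fun z => fderiv ℂ f z v) U := by
  intro z₀ hz₀
  obtain ⟨R, hR, hRU⟩ : ∃ R > 0, ball z₀ R ⊆ U := Metric.isOpen_iff.1 hU z₀ hz₀
  -- circles of radius `ρ` in the direction `v` around points near `z₀` stay in `U`
  obtain ⟨ρ, hρ, hρv⟩ : ∃ ρ > 0, ρ * ‖v‖ < R / 2 := by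
    refine ⟨R / 2 / (‖v‖ + 1), by positivity, ?_⟩
    rw [div_mul_eq_mul_div, div_lt_iff₀ (by positivity)]
    nlinarith
  have hmem : ∀ z ∈ ball z₀ (R / 2), ∀ t ∈ closedBall (0 : ℂ) ρ, z + t • v ∈ U := by
    intro z hz t ht
    refine hRU ?_
    rw [mem_ball, dist_eq_norm] at *
    rw [mem_closedBall_zero_iff] at ht
    calc ‖z + t • v - z₀‖ = ‖(z - z₀) + t • v‖ := by congr 1; abel
      _ ≤ ‖z - z₀‖ + ‖t‖ * ‖v‖ := (norm_add_le _ _).trans_eq (by rw [norm_smul])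
      _ < R / 2 + R / 2 := by
        refine add_lt_add hz (lt_of_le_of_lt ?_ hρv)
        gcongr
      _ = R := add_halves R
  have hint : DifferentiableOn ℂ (fun z => ∫ θ in (0 : ℝ)..2 * Real.pi,
      ((2 * Real.pi * Complex.I)⁻¹ * (deriv (circleMap 0 ρ) θ * ((circleMap 0 ρ θ) ^ 2)⁻¹)) *
        f ((1 : ℂ) • z + circleMap 0 ρ θ • v)) (ball z₀ (R / 2)) := by
    refine differentiableOn_integral_comp hU isOpen_ball hf ?_ continuous_const (by fun_prop)
      (fun z hz θ => ?_) _ _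
    · simp only [deriv_circleMap]
      refine continuous_const.mul (Continuous.mul (by fun_prop) (Continuous.inv₀ (by fun_prop) ?_))
      intro θ
      exact pow_ne_zero _ (circleMap_ne_center hρ.ne')
    · rw [one_smul]
      exact hmem z hz _ (circleMap_mem_closedBall 0 hρ.le θ)
  refine (DifferentiableAt.congr_of_eventuallyEq
    (hint.differentiableAt (ball_mem_nhds z₀ (half_pos hR))) ?_).differentiableWithinAt
  filter_upwards [ball_mem_nhds z₀ (half_pos hR)] with z hz
  have hline : Differentiable ℂ fun t : ℂ => z + t • v := by fun_prop
  have hzU : z ∈ U := by simpa using hmem z hz 0 (mem_closedBall_self hρ.le)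
  have hpre : IsOpen ((fun t : ℂ => z + t • v) ⁻¹' U) := hU.preimage (by fun_prop)
  have hd : DifferentiableOn ℂ (fun t : ℂ => f (z + t • v)) ((fun t : ℂ => z + t • v) ⁻¹' U) :=
    hf.comp (fun t _ => (hline t).differentiableWithinAt) fun t ht => ht
  have := Complex.two_pi_I_inv_smul_circleIntegral_sub_sq_inv_smul_of_differentiable hpre
    (fun t ht => hmem z hz t ht) hd (mem_ball_self hρ)
  rw [← deriv_comp_line (hf.differentiableAt (hU.mem_nhds hzU)), ← this, circleIntegral,
    smul_eq_mul, ← intervalIntegral.integral_const_mul]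
  simp only [sub_zero, smul_eq_mul, one_smul, mul_assoc]

/-! ### Circle means of a polynomial times a dilated function -/

theorem integral_circle_rotate {u : ℂ → ℝ} {w : ℂ} (hw : ‖w‖ = 1) :
    ∫ θ in (0 : ℝ)..2 * Real.pi, u (w * circleMap 0 1 θ) =
      ∫ θ in (0 : ℝ)..2 * Real.pi, u (circleMap 0 1 θ) := by
  have hw' : w = Complex.exp (w.arg * Complex.I) := by
    simpa [hw] using (Complex.norm_mul_exp_arg_mul_I w).symm
  have h1 : ∀ θ : ℝ, w * circleMap 0 1 θ = circleMap 0 1 (θ + w.arg) := by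
    intro θ
    nth_rewrite 1 [hw']
    simp [circleMap, ← Complex.exp_add]
    ring_nf
  simp only [h1]
  have := intervalIntegral.integral_comp_add_right (a := 0) (b := 2 * Real.pi)
    (fun θ => u (circleMap 0 1 θ)) w.arg
  rw [this]
  have hper : Function.Periodic (fun θ => u (circleMap 0 1 θ)) (2 * Real.pi) := fun θ => by
    simp [periodic_circleMap 0 1 θ]
  simpa [add_comm] using hper.intervalIntegral_add_eq w.arg 0

/-- The quadratic mean of a holomorphic function over circles increases with the radius. With
`H(w) = ∫ G(wζ) * conj (G(rζ))` over the unit circle, `H(r)` is the quadratic mean `I(r)`, and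
`|H(w)| ≤ (I(r) + I(1)) / 2` for `|w| = 1`; so the maximum principle gives
`I(r) ≤ (I(r) + I(1)) / 2`. -/
theorem integral_circle_norm_sq_le {G : ℂ → ℂ} {R : ℝ} (hR : 1 < R)
    (hG : DifferentiableOn ℂ G (ball 0 R)) {r : ℝ} (hr0 : 0 ≤ r) (hr1 : r ≤ 1) :
    ∫ θ in (0 : ℝ)..2 * Real.pi, ‖G (r * circleMap 0 1 θ)‖ ^ 2 ≤
      ∫ θ in (0 : ℝ)..2 * Real.pi, ‖G (circleMap 0 1 θ)‖ ^ 2 := by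
  have hmem : ∀ w : ℂ, ‖w‖ < R → ∀ θ, w * circleMap 0 1 θ ∈ ball (0 : ℂ) R := by
    intro w hw θ
    simpa using hw
  have hcont : ∀ w : ℂ, ‖w‖ < R → Continuous fun θ => G (w * circleMap 0 1 θ) := fun w hw =>
    hG.continuousOn.comp_continuous (by fun_prop) (hmem w hw)
  have hrR : ‖(r : ℂ)‖ < R := by
    rw [Complex.norm_real, Real.norm_of_nonneg hr0]; linarith
  set I : ℂ → ℝ := fun w => ∫ θ in (0 : ℝ)..2 * Real.pi, ‖G (w * circleMap 0 1 θ)‖ ^ 2 with hI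
  set H : ℂ → ℂ := fun w => ∫ θ in (0 : ℝ)..2 * Real.pi,
    conj (G (r * circleMap 0 1 θ)) * G (circleMap 0 1 θ • w + 0) with hH
  have hHd : DifferentiableOn ℂ H (ball 0 R) :=
    differentiableOn_integral_comp isOpen_ball isOpen_ball hG
      (Complex.continuous_conj.comp (hcont r hrR)) (by fun_prop) continuous_const
      (fun z hz θ => by simpa using hz) _ _
  have hHr : H r = I r := by
    simp only [hH, hI]
    rw [← intervalIntegral.integral_ofReal]
    refine intervalIntegral.integral_congr fun θ _ => ?_
    simp only [smul_eq_mul, add_zero]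
    rw [mul_comm (circleMap 0 1 θ), ← Complex.normSq_eq_conj_mul_self, Complex.normSq_eq_norm_sq]
  have hHw : ∀ w ∈ frontier (ball (0 : ℂ) 1), ‖H w‖ ≤ (I r + I 1) / 2 := by
    intro w hw
    have hw1 : ‖w‖ = 1 := by simpa using frontier_ball_subset_sphere hw
    have hwR : ‖w‖ < R := by rw [hw1]; exact hR
    have hIw : I w = I 1 := by
      simp only [hI, one_mul]
      exact integral_circle_rotate (u := fun z => ‖G z‖ ^ 2) hw1
    have hsum : (I r + I w) / 2 = ∫ θ in (0 : ℝ)..2 * Real.pi,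
        (‖G (r * circleMap 0 1 θ)‖ ^ 2 + ‖G (w * circleMap 0 1 θ)‖ ^ 2) / 2 := by
      rw [intervalIntegral.integral_div, intervalIntegral.integral_add
        (f := fun θ => ‖G (r * circleMap 0 1 θ)‖ ^ 2) (g := fun θ => ‖G (w * circleMap 0 1 θ)‖ ^ 2)
        (((hcont r hrR).norm.pow 2).intervalIntegrable _ _)
        (((hcont w hwR).norm.pow 2).intervalIntegrable _ _)]
    rw [← hIw, hsum]
    refine intervalIntegral.norm_integral_le_of_norm_le (by positivity) (.of_forall fun θ _ => ?_)
      (Continuous.intervalIntegrable ?_ _ _)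
    · rw [norm_mul, RCLike.norm_conj, smul_eq_mul, add_zero, mul_comm (circleMap 0 1 θ)]
      nlinarith [sq_nonneg (‖G (r * circleMap 0 1 θ)‖ - ‖G (w * circleMap 0 1 θ)‖)]
    · exact (((hcont r hrR).norm.pow 2).add ((hcont w hwR).norm.pow 2)).div_const 2
  have hmax : ‖H r‖ ≤ (I r + I 1) / 2 := by
    refine Complex.norm_le_of_forall_mem_frontier_norm_le isBounded_ball
      (hHd.mono ?_ |>.diffContOnCl) hHw ?_
    · exact closure_ball_subset_closedBall.trans (closedBall_subset_ball hR)
    · rw [closure_ball _ one_ne_zero]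
      simpa [abs_of_nonneg hr0] using hr1
  have hle : I r ≤ ‖H r‖ := by
    rw [hHr]
    exact (le_abs_self _).trans_eq (by simp)
  have : I r ≤ I 1 := by linarith
  simpa [hI] using this

/-- Reflecting the roots of `P` that lie inside the unit disc in the unit circle, that is,
replacing such a factor `ζ - a` by `1 - conj a * ζ`, keeps the modulus on the circle and produces a
function `Q` with `|Q(rζ)| ≥ |P(ζ)| / 2 ^ N` along radii. -/
theorem exists_norm_eq_and_norm_le_dilate (N : ℕ) : ∀ P : Polynomial ℂ, P.natDegree ≤ N →
    ∃ Q : ℂ → ℂ, Differentiable ℂ Q ∧ (∀ ζ : ℂ, ‖ζ‖ = 1 → ‖Q ζ‖ = ‖P.eval ζ‖) ∧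
      ∀ ζ : ℂ, ‖ζ‖ = 1 → ∀ r : ℝ, 0 ≤ r → r ≤ 1 → ‖P.eval ζ‖ ≤ 2 ^ N * ‖Q (r * ζ)‖ := by
  induction N with
  | zero =>
    intro P hP
    obtain ⟨c, rfl⟩ := Polynomial.natDegree_eq_zero.1 (Nat.le_zero.1 hP)
    exact ⟨fun _ => c, differentiable_const c, by simp, by simp⟩
  | succ N ih =>
    intro P hP
    by_cases hdeg : P.degree = 0 ∨ P = 0
    · obtain ⟨c, rfl⟩ : ∃ c, P = Polynomial.C c := by
        rcases hdeg with h | h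
        · exact ⟨_, Polynomial.eq_C_of_degree_eq_zero h⟩
        · exact ⟨0, by simp [h]⟩
      refine ⟨fun _ => c, differentiable_const c, by simp, fun ζ _ r _ _ => ?_⟩
      simpa using le_mul_of_one_le_left (norm_nonneg c) (one_le_pow₀ (by norm_num : (1 : ℝ) ≤ 2))
    push Not at hdeg
    obtain ⟨a, ha⟩ := Complex.exists_root (f := P)
      (lt_of_le_of_ne (by simpa using Polynomial.zero_le_degree_iff.2 hdeg.2) (Ne.symm hdeg.1))
    obtain ⟨P', rfl⟩ := Polynomial.dvd_iff_isRoot.2 ha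
    have hP' : P'.natDegree ≤ N := by
      have h0 : P' ≠ 0 := right_ne_zero_of_mul hdeg.2
      rw [Polynomial.natDegree_mul (Polynomial.X_sub_C_ne_zero a) h0,
        Polynomial.natDegree_X_sub_C] at hP
      omega
    obtain ⟨Q, hQd, hQ1, hQ2⟩ := ih P' hP'
    obtain ⟨b, hbd, hb1, hb2⟩ : ∃ b : ℂ → ℂ, Differentiable ℂ b ∧
        (∀ ζ : ℂ, ‖ζ‖ = 1 → ‖b ζ‖ = ‖ζ - a‖) ∧
        ∀ ζ : ℂ, ‖ζ‖ = 1 → ∀ r : ℝ, 0 ≤ r → r ≤ 1 → ‖ζ - a‖ ≤ 2 * ‖b (r * ζ)‖ := by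
      have hstep : ∀ ζ : ℂ, ‖ζ‖ = 1 → ∀ r : ℝ, 0 ≤ r → r ≤ 1 →
          ‖ζ - r * ζ‖ = 1 - r ∧ ‖r * ζ‖ = r := by
        intro ζ hζ r hr0 hr1
        constructor
        · rw [show ζ - r * ζ = ((1 - r : ℝ) : ℂ) * ζ by push_cast; ring, norm_mul, hζ, mul_one,
            Complex.norm_real, Real.norm_of_nonneg (by linarith)]
        · rw [norm_mul, hζ, mul_one, Complex.norm_real, Real.norm_of_nonneg hr0]
      -- a root outside the open disc is kept, a root inside is reflected in the circle
      rcases le_or_gt 1 ‖a‖ with h1 | h1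
      · refine ⟨fun ζ => ζ - a, by fun_prop, fun _ _ => rfl, fun ζ hζ r hr0 hr1 => ?_⟩
        obtain ⟨h2, h3⟩ := hstep ζ hζ r hr0 hr1
        have h4 : ‖ζ - a‖ ≤ ‖ζ - r * ζ‖ + ‖r * ζ - a‖ := norm_sub_le_norm_sub_add_norm_sub _ _ _
        have h5 : ‖a‖ - ‖r * ζ‖ ≤ ‖r * ζ - a‖ := by
          rw [norm_sub_rev]; exact norm_sub_norm_le _ _
        linarith
      · have hrefl : ∀ ζ : ℂ, ‖ζ‖ = 1 → ‖1 - conj a * ζ‖ = ‖ζ - a‖ := by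
          intro ζ hζ
          have : 1 - conj a * ζ = ζ * conj (ζ - a) := by
            rw [map_sub, mul_sub, Complex.mul_conj, Complex.normSq_eq_norm_sq, hζ]
            push_cast
            ring
          rw [this, norm_mul, hζ, one_mul, RCLike.norm_conj]
        refine ⟨fun ζ => 1 - conj a * ζ, by fun_prop, hrefl, fun ζ hζ r hr0 hr1 => ?_⟩
        obtain ⟨h2, h3⟩ := hstep ζ hζ r hr0 hr1
        rw [← hrefl ζ hζ]
        have h4 : ‖1 - conj a * ζ‖ ≤ ‖1 - conj a * (r * ζ)‖ + ‖a‖ * (1 - r) := by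
          rw [← h2, ← RCLike.norm_conj a, ← norm_mul]
          refine (norm_sub_le _ _).trans' (le_of_eq ?_)
          congr 1
          ring
        have h5 : 1 - ‖a‖ * r ≤ ‖1 - conj a * (r * ζ)‖ := by
          have := norm_sub_norm_le (1 : ℂ) (conj a * (r * ζ))
          rwa [norm_one, norm_mul, h3, RCLike.norm_conj] at this
        have h6 := norm_nonneg a
        change _ ≤ 2 * ‖1 - conj a * (r * ζ)‖
        nlinarith
    refine ⟨fun ζ => b ζ * Q ζ, hbd.mul hQd, fun ζ hζ => ?_, fun ζ hζ r hr0 hr1 => ?_⟩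
    · simp [hb1 ζ hζ, hQ1 ζ hζ]
    · have := mul_le_mul (hb2 ζ hζ r hr0 hr1) (hQ2 ζ hζ r hr0 hr1) (norm_nonneg _) (by positivity)
      simp only [Polynomial.eval_mul, Polynomial.eval_sub, Polynomial.eval_X, Polynomial.eval_C,
        norm_mul]
      exact this.trans_eq (by ring)

/-- Replacing `F` by its dilation increases the `L²` norm of `P * F` on the unit circle by at most
a constant that depends only on the degree of `P`. -/
theorem integral_circle_poly_mul_le {P : Polynomial ℂ} {N : ℕ} (hP : P.natDegree ≤ N)
    {F : ℂ → ℂ} {R : ℝ} (hR : 1 < R) (hF : DifferentiableOn ℂ F (ball 0 R)) {r : ℝ}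
    (hr0 : 0 ≤ r) (hr1 : r ≤ 1) :
    ∫ θ in (0 : ℝ)..2 * Real.pi, ‖P.eval (circleMap 0 1 θ) * F (r * circleMap 0 1 θ)‖ ^ 2 ≤
      4 ^ N * ∫ θ in (0 : ℝ)..2 * Real.pi,
        ‖P.eval (circleMap 0 1 θ) * F (circleMap 0 1 θ)‖ ^ 2 := by
  obtain ⟨Q, hQd, hQ1, hQ2⟩ := exists_norm_eq_and_norm_le_dilate N P hP
  have hunit : ∀ θ, ‖circleMap 0 1 θ‖ = 1 := fun θ => by simp
  have hmem : ∀ θ, (r : ℂ) * circleMap 0 1 θ ∈ ball (0 : ℂ) R := fun θ => by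
    simp only [mem_ball_zero_iff, norm_mul, hunit, mul_one, Complex.norm_real,
      Real.norm_of_nonneg hr0]
    linarith
  have hFc : Continuous fun θ => F (r * circleMap 0 1 θ) :=
    hF.continuousOn.comp_continuous (by fun_prop) hmem
  have hQc : Continuous fun θ => Q (r * circleMap 0 1 θ) :=
    hQd.continuous.comp (by fun_prop)
  have hPc : Continuous fun θ => P.eval (circleMap 0 1 θ) :=
    P.continuous.comp (by fun_prop)
  calc ∫ θ in (0 : ℝ)..2 * Real.pi, ‖P.eval (circleMap 0 1 θ) * F (r * circleMap 0 1 θ)‖ ^ 2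
      ≤ ∫ θ in (0 : ℝ)..2 * Real.pi,
          4 ^ N * ‖Q (r * circleMap 0 1 θ) * F (r * circleMap 0 1 θ)‖ ^ 2 := by
        refine intervalIntegral.integral_mono (by positivity)
          (((hPc.mul hFc).norm.pow 2).intervalIntegrable _ _)
          ((((hQc.mul hFc).norm.pow 2).const_mul _).intervalIntegrable _ _) fun θ => ?_
        have h := hQ2 _ (hunit θ) r hr0 hr1
        simp only [norm_mul]
        calc (‖P.eval (circleMap 0 1 θ)‖ * ‖F (r * circleMap 0 1 θ)‖) ^ 2
            ≤ (2 ^ N * ‖Q (r * circleMap 0 1 θ)‖ * ‖F (r * circleMap 0 1 θ)‖) ^ 2 := by gcongr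
          _ = (2 ^ N) ^ 2 * (‖Q (r * circleMap 0 1 θ)‖ * ‖F (r * circleMap 0 1 θ)‖) ^ 2 := by ring
          _ = _ := by rw [← pow_mul, mul_comm N, pow_mul]; norm_num
    _ = 4 ^ N * ∫ θ in (0 : ℝ)..2 * Real.pi,
          ‖Q (r * circleMap 0 1 θ) * F (r * circleMap 0 1 θ)‖ ^ 2 :=
        intervalIntegral.integral_const_mul _ _
    _ ≤ 4 ^ N * ∫ θ in (0 : ℝ)..2 * Real.pi, ‖Q (circleMap 0 1 θ) * F (circleMap 0 1 θ)‖ ^ 2 := by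
        gcongr
        exact integral_circle_norm_sq_le (G := fun ζ => Q ζ * F ζ) hR
          (hQd.differentiableOn.mul hF) hr0 hr1
    _ = _ := by simp only [norm_mul, hQ1 _ (hunit _)]

/-! ### Polynomial approximation of holomorphic functions on smaller balls -/

theorem differentiableAt_slice {n : ℕ} {h : Cn n → ℂ} {U : Set (Cn n)} (hU : IsOpen U)
    (hh : DifferentiableOn ℂ h U) {z : Cn n} {ζ : ℂ} (hz : ζ • z ∈ U) :
    DifferentiableAt ℂ (fun ζ : ℂ => h (ζ • z)) ζ :=
  (hh.differentiableAt (hU.mem_nhds hz)).comp ζ (by fun_prop)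

/-- The homogeneous components of the Taylor series at `0`, here without the factor `1 / k!`, are
polynomials, by induction on the degree: `d/dζ h(ζz) = ∑ zᵢ (∂ᵢh)(ζz)`. -/
theorem exists_polyFun_eq_iteratedDeriv {n : ℕ} {U : Set (Cn n)} (hU : IsOpen U)
    (h0 : (0 : Cn n) ∈ U) (k : ℕ) : ∀ h : Cn n → ℂ, DifferentiableOn ℂ h U →
    ∃ q : MvPolynomial (Fin n) ℂ, ∀ z,
      polyFun q z = iteratedDeriv k (fun ζ : ℂ => h (ζ • z)) 0 := by
  induction k with
  | zero =>
    intro h _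
    exact ⟨MvPolynomial.C (h 0), fun z => by simp [polyFun]⟩
  | succ k ih =>
    intro h hh
    let e : Fin n → Cn n := fun i => EuclideanSpace.single i 1
    have hpart : ∀ i, DifferentiableOn ℂ (fun w => fderiv ℂ h w (e i)) U := fun i =>
      differentiableOn_fderiv_apply hU hh (e i)
    choose q hq using fun i => ih _ (hpart i)
    refine ⟨∑ i, MvPolynomial.X i * q i, fun z => ?_⟩
    have hopen : IsOpen ((fun ζ : ℂ => ζ • z) ⁻¹' U) := hU.preimage (by fun_prop)
    have hmem : (fun ζ : ℂ => ζ • z) ⁻¹' U ∈ 𝓝 (0 : ℂ) := hopen.mem_nhds (by simpa using h0)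
    have hz : z = ∑ i, z i • e i := by
      ext j
      simp [e, Finset.sum_apply, Pi.single_apply]
    have hder : deriv (fun ζ : ℂ => h (ζ • z)) =ᶠ[𝓝 0]
        fun ζ => ∑ i, z i * fderiv ℂ h (ζ • z) (e i) := by
      filter_upwards [hmem] with ζ hζ
      have hl : HasDerivAt (fun ζ : ℂ => ζ • z) z ζ := by
        simpa using (hasDerivAt_id ζ).smul_const z
      have := ((hh.differentiableAt (hU.mem_nhds hζ)).hasFDerivAt.comp_hasDerivAt ζ hl).deriv
      change deriv (fun ζ : ℂ => h (ζ • z)) ζ = _ at this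
      rw [this]
      conv_lhs => enter [2]; rw [hz]
      rw [map_sum]
      simp
    have hcd : ∀ i, ContDiffAt ℂ k (fun ζ : ℂ => fderiv ℂ h (ζ • z) (e i)) 0 := by
      intro i
      refine AnalyticAt.contDiffAt (DifferentiableOn.analyticAt (s := (fun ζ : ℂ => ζ • z) ⁻¹' U)
        (fun ζ hζ => ?_) hmem)
      exact (differentiableAt_slice hU (hpart i) hζ).differentiableWithinAt
    rw [iteratedDeriv_succ', hder.iteratedDeriv_eq,
      iteratedDeriv_fun_sum fun i _ => contDiffAt_const.mul (hcd i)]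
    simp only [polyFun, map_sum, map_mul, MvPolynomial.eval_X]
    refine Finset.sum_congr rfl fun i _ => ?_
    rw [iteratedDeriv_const_mul (z i) (hcd i), ← hq i z]
    rfl

/-- A holomorphic function on the unit ball is a uniform limit of polynomials on smaller balls: its
expansion in homogeneous polynomials converges uniformly there. -/
theorem exists_polyFun_approx {n : ℕ} {h : Cn n → ℂ} (hh : DifferentiableOn ℂ h (unitBall n))
    {r : ℝ} (hr0 : 0 < r) (hr1 : r < 1) {ε : ℝ} (hε : 0 < ε) :
    ∃ q : MvPolynomial (Fin n) ℂ, ∀ z ∈ closedBall (0 : Cn n) r, ‖h z - polyFun q z‖ < ε := by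
  obtain ⟨s, hrs, hs1⟩ := exists_between hr1
  have hs0 : 0 < s := hr0.trans hrs
  obtain ⟨M, hM⟩ := (isCompact_closedBall (0 : Cn n) s).exists_bound_of_continuousOn
    (hh.continuousOn.mono (closedBall_subset_ball hs1))
  choose q hq using fun k => exists_polyFun_eq_iteratedDeriv (U := unitBall n) isOpen_ball
    (mem_ball_self one_pos) k h hh
  -- circles of radius `s / r > 1` around `0` in the slices through points of norm at most `r`
  have hR1 : 1 < s / r := (one_lt_div hr0).2 hrs
  have hmem : ∀ z ∈ closedBall (0 : Cn n) r, ∀ ζ ∈ closedBall (0 : ℂ) (s / r),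
      ζ • z ∈ closedBall (0 : Cn n) s := by
    intro z hz ζ hζ
    rw [mem_closedBall_zero_iff] at *
    rw [norm_smul]
    calc ‖ζ‖ * ‖z‖ ≤ s / r * r := by gcongr
      _ = s := div_mul_cancel₀ s hr0.ne'
  have hd : ∀ z ∈ closedBall (0 : Cn n) r,
      DifferentiableOn ℂ (fun ζ : ℂ => h (ζ • z)) (closedBall 0 (s / r)) := fun z hz ζ hζ =>
    (differentiableAt_slice isOpen_ball hh
      (closedBall_subset_ball hs1 (hmem z hz ζ hζ))).differentiableWithinAt
  have hsum : ∀ z ∈ closedBall (0 : Cn n) r,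
      HasSum (fun k : ℕ => ((k.factorial : ℂ))⁻¹ * polyFun (q k) z) (h z) := by
    intro z hz
    have := Complex.hasSum_taylorSeries_on_ball ((hd z hz).mono ball_subset_closedBall)
      (z := 1) (by simpa using hR1)
    simpa [hq] using this
  have hbound : ∀ (k : ℕ), ∀ z ∈ closedBall (0 : Cn n) r,
      ‖((k.factorial : ℂ))⁻¹ * polyFun (q k) z‖ ≤ M * (r / s) ^ k := by
    intro k z hz
    have := Complex.norm_iteratedDeriv_le_of_forall_mem_sphere_norm_le k (by positivity)
      ((hd z hz).mono closure_ball_subset_closedBall).diffContOnCl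
      fun ζ hζ => hM _ (hmem z hz ζ (sphere_subset_closedBall hζ))
    rw [hq, norm_mul, norm_inv, Complex.norm_natCast]
    have hk : (0 : ℝ) < k.factorial := by positivity
    calc ((k.factorial : ℝ))⁻¹ * _ ≤ ((k.factorial : ℝ))⁻¹ * (k.factorial * M / (s / r) ^ k) := by
          gcongr
      _ = M * (r / s) ^ k := by rw [← inv_div s r, inv_pow]; field_simp
  have hunif := tendstoUniformlyOn_tsum_nat (u := fun k => M * (r / s) ^ k)
    ((summable_geometric_of_lt_one (by positivity) ((div_lt_one hs0).2 hrs)).mul_left M) hbound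
  obtain ⟨K, hK⟩ := (Metric.tendstoUniformlyOn_iff.1 hunif ε hε).exists
  refine ⟨∑ k ∈ Finset.range K, MvPolynomial.C (((k.factorial : ℂ))⁻¹) * q k, fun z hz => ?_⟩
  have := hK z hz
  rw [(hsum z hz).tsum_eq, dist_eq_norm] at this
  simpa [polyFun] using this

/-! ### Point evaluations on the Bergman space -/

theorem measurePreserving_smul {n : ℕ} {c : ℂ} (hc : ‖c‖ = 1) :
    MeasurePreserving (fun z : Cn n => c • z) volume volume := by
  have hc0 : c ≠ 0 := norm_ne_zero_iff.1 (hc ▸ one_ne_zero)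
  let e : Cn n ≃ₗᵢ[ℝ] Cn n :=
    { (LinearEquiv.smulOfNeZero ℂ (Cn n) c hc0).restrictScalars ℝ with
      norm_map' := fun z => by
        change ‖c • z‖ = ‖z‖
        rw [norm_smul, hc, one_mul] }
  exact e.measurePreserving

/-- Averaging over the rotations `z ↦ e^{iθ} z` does not change the integral. -/
theorem lintegral_lintegral_rotate {n : ℕ} {F : Cn n → ℝ≥0∞} (hF : Measurable F) :
    ∫⁻ z, ∫⁻ θ in Set.Ioc 0 (2 * Real.pi), F (circleMap 0 1 θ • z) =
      ENNReal.ofReal (2 * Real.pi) * ∫⁻ z, F z := by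
  rw [lintegral_lintegral_swap]
  · have h : ∀ θ : ℝ, ∫⁻ z, F (circleMap 0 1 θ • z) = ∫⁻ z : Cn n, F z := fun θ =>
      (measurePreserving_smul (by simp)).lintegral_comp hF
    simp [h, mul_comm]
  · refine (hF.comp (Continuous.measurable ?_)).aemeasurable
    exact ((continuous_circleMap 0 1).comp continuous_snd).smul continuous_fst

theorem measurable_indicator_of_continuousOn {X Y : Type*} [TopologicalSpace X]
    [MeasurableSpace X] [OpensMeasurableSpace X] [TopologicalSpace Y] [MeasurableSpace Y]
    [BorelSpace Y] [Zero Y] {U : Set X} (hU : IsOpen U) {g : X → Y} (hg : ContinuousOn g U) :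
    Measurable (U.indicator g) := by
  classical
  rw [← Set.piecewise_eq_indicator]
  exact hg.measurable_piecewise continuousOn_const hU.measurableSet

/-- The sub-mean value property over balls for the modulus of a holomorphic function, obtained by
averaging the mean value property on the circles `θ ↦ z + e^{iθ} w` over `w`. -/
theorem enorm_mul_volume_ball_le {n : ℕ} {g : Cn n → ℂ} {U : Set (Cn n)} (hU : IsOpen U)
    (hg : DifferentiableOn ℂ g U) {z : Cn n} {s : ℝ} (hs : ball z s ⊆ U) :
    ‖g z‖ₑ * volume (ball (0 : Cn n) s) ≤ ∫⁻ w in U, ‖g w‖ₑ := by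
  -- cutting off makes the integrands measurable on all of `ℂⁿ`, whatever `g` is outside `U`
  set G : Cn n → ℝ≥0∞ := U.indicator fun w => ‖g w‖ₑ with hG
  have hGm : Measurable G := measurable_indicator_of_continuousOn hU hg.continuousOn.enorm
  set F : Cn n → ℝ≥0∞ := (ball 0 s).indicator fun w => G (z + w) with hF
  have hFm : Measurable F := (hGm.comp (measurable_const_add z)).indicator measurableSet_ball
  have hmean : ∀ w ∈ ball (0 : Cn n) s, ENNReal.ofReal (2 * Real.pi) * ‖g z‖ₑ ≤
      ∫⁻ θ in Set.Ioc 0 (2 * Real.pi), F (circleMap 0 1 θ • w) := by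
    intro w hw
    have hmem : ∀ ζ ∈ closedBall (0 : ℂ) 1, ζ • w ∈ ball (0 : Cn n) s := by
      intro ζ hζ
      rw [mem_closedBall_zero_iff] at hζ
      rw [mem_ball_zero_iff] at *
      rw [norm_smul]
      exact (mul_le_of_le_one_left (norm_nonneg w) hζ).trans_lt hw
    have hmemU : ∀ ζ ∈ closedBall (0 : ℂ) 1, z + ζ • w ∈ U := fun ζ hζ =>
      hs (by simpa using hmem ζ hζ)
    have hd : DiffContOnCl ℂ (fun ζ : ℂ => g (z + ζ • w)) (ball 0 |1|) := by
      refine DifferentiableOn.diffContOnCl fun ζ hζ => ?_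
      rw [abs_one] at hζ
      exact ((hg.differentiableAt (hU.mem_nhds (hmemU ζ (closure_ball_subset_closedBall hζ)))).comp ζ
        (by fun_prop)).differentiableWithinAt
    have havg := hd.circleAverage
    rw [Real.circleAverage_def, zero_smul, add_zero] at havg
    have hpi : (0 : ℝ) < 2 * Real.pi := by positivity
    have hint : ((2 * Real.pi : ℝ)) • g z =
        ∫ θ in Set.Ioc 0 (2 * Real.pi), g (z + circleMap 0 1 θ • w) := by
      rw [← havg, smul_smul, mul_inv_cancel₀ hpi.ne', one_smul,
        intervalIntegral.integral_of_le hpi.le]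
    have henorm : ‖(2 * Real.pi : ℝ)‖ₑ = ENNReal.ofReal (2 * Real.pi) :=
      Real.enorm_of_nonneg hpi.le
    rw [← henorm, ← enorm_smul, hint]
    refine (enorm_integral_le_lintegral_enorm _).trans_eq (lintegral_congr fun θ => ?_)
    have hθ : circleMap 0 1 θ ∈ closedBall (0 : ℂ) 1 := circleMap_mem_closedBall 0 zero_le_one θ
    rw [hF, Set.indicator_of_mem (hmem _ hθ), hG, Set.indicator_of_mem (hmemU _ hθ)]
  have hpi0 : ENNReal.ofReal (2 * Real.pi) ≠ 0 := by
    rw [Ne, ENNReal.ofReal_eq_zero, not_le]; positivity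
  rw [← ENNReal.mul_le_mul_iff_right hpi0 ENNReal.ofReal_ne_top, ← mul_assoc]
  calc ENNReal.ofReal (2 * Real.pi) * ‖g z‖ₑ * volume (ball (0 : Cn n) s)
      = ∫⁻ _ in ball (0 : Cn n) s, ENNReal.ofReal (2 * Real.pi) * ‖g z‖ₑ := by simp
    _ ≤ ∫⁻ w in ball (0 : Cn n) s, ∫⁻ θ in Set.Ioc 0 (2 * Real.pi), F (circleMap 0 1 θ • w) :=
        setLIntegral_mono' measurableSet_ball hmean
    _ ≤ ∫⁻ w, ∫⁻ θ in Set.Ioc 0 (2 * Real.pi), F (circleMap 0 1 θ • w) :=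
        setLIntegral_le_lintegral _ _
    _ = ENNReal.ofReal (2 * Real.pi) * ∫⁻ w, F w := lintegral_lintegral_rotate hFm
    _ ≤ ENNReal.ofReal (2 * Real.pi) * ∫⁻ w, G (z + w) := by
        gcongr with w
        exact Set.indicator_le_self _ _ w
    _ = ENNReal.ofReal (2 * Real.pi) * ∫⁻ w in U, ‖g w‖ₑ := by
        rw [lintegral_add_left_eq_self, hG, lintegral_indicator hU.measurableSet]

theorem volume_unitBall_ne_zero (n : ℕ) : volume (unitBall n) ≠ 0 :=
  (measure_ball_pos volume 0 one_pos).ne'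

theorem volume_unitBall_ne_top (n : ℕ) : volume (unitBall n) ≠ ∞ :=
  measure_ball_lt_top.ne

instance isProbabilityMeasure_ballMeasure (n : ℕ) : IsProbabilityMeasure (ballMeasure n) := by
  constructor
  simp only [ballMeasure, Measure.smul_apply, Measure.restrict_apply_univ, smul_eq_mul]
  exact ENNReal.inv_mul_cancel (volume_unitBall_ne_zero n) (volume_unitBall_ne_top n)

theorem enorm_le_mul_eLpNorm {n : ℕ} {g : Cn n → ℂ} (hg : DifferentiableOn ℂ g (unitBall n))
    {z : Cn n} {s : ℝ} (hs0 : 0 < s) (hs : ball z s ⊆ unitBall n) :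
    ‖g z‖ₑ ≤ volume (unitBall n) / volume (ball (0 : Cn n) s) * eLpNorm g 2 (ballMeasure n) := by
  have hgm : AEStronglyMeasurable g (ballMeasure n) :=
    (hg.continuousOn.aestronglyMeasurable isOpen_ball.measurableSet).smul_measure _
  have h1 : ∫⁻ w in unitBall n, ‖g w‖ₑ = volume (unitBall n) * eLpNorm g 1 (ballMeasure n) := by
    rw [eLpNorm_one_eq_lintegral_enorm, ballMeasure, lintegral_smul_measure, smul_eq_mul,
      ← mul_assoc, ENNReal.mul_inv_cancel (volume_unitBall_ne_zero n) (volume_unitBall_ne_top n),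
      one_mul]
  have h2 : eLpNorm g 1 (ballMeasure n) ≤ eLpNorm g 2 (ballMeasure n) :=
    eLpNorm_le_eLpNorm_of_exponent_le one_le_two hgm
  have h3 : ‖g z‖ₑ * volume (ball (0 : Cn n) s) ≤ ∫⁻ w in unitBall n, ‖g w‖ₑ :=
    enorm_mul_volume_ball_le isOpen_ball hg hs
  rw [← ENNReal.le_div_iff_mul_le (.inl (measure_ball_pos volume 0 hs0).ne')
    (.inl measure_ball_lt_top.ne), h1] at h3
  refine h3.trans ?_
  rw [ENNReal.div_eq_inv_mul, ENNReal.div_eq_inv_mul, ← mul_assoc]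
  gcongr

theorem tendstoUniformlyOn_of_tendsto_eLpNorm {n : ℕ} {f : Cn n → ℂ}
    (hf : DifferentiableOn ℂ f (unitBall n)) {g : ℕ → Cn n → ℂ}
    (hg : ∀ k, DifferentiableOn ℂ (g k) (unitBall n))
    (hlim : Tendsto (fun k => eLpNorm (f - g k) 2 (ballMeasure n)) atTop (𝓝 0))
    {K : Set (Cn n)} (hK : IsCompact K) (hKB : K ⊆ unitBall n) :
    TendstoUniformlyOn g f atTop K := by
  obtain ⟨s, hs0, hs⟩ := hK.exists_thickening_subset_open isOpen_ball hKB
  set C := volume (unitBall n) / volume (ball (0 : Cn n) s) with hC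
  have hCtop : C ≠ ∞ :=
    ENNReal.div_ne_top (volume_unitBall_ne_top n) (measure_ball_pos volume 0 hs0).ne'
  rw [EMetric.tendstoUniformlyOn_iff]
  intro ε hε
  have hlim' : Tendsto (fun k => C * eLpNorm (f - g k) 2 (ballMeasure n)) atTop (𝓝 0) := by
    simpa using ENNReal.Tendsto.const_mul hlim (.inr hCtop)
  filter_upwards [hlim'.eventually_lt_const hε] with k hk z hz
  rw [edist_eq_enorm_sub]
  exact (enorm_le_mul_eLpNorm (hf.sub (hg k)) hs0
    ((ball_subset_thickening hz s).trans hs)).trans_lt hk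

theorem mem_principalSubmodule_iff {n : ℕ} (p : MvPolynomial (Fin n) ℂ) {f : Cn n → ℂ}
    (hf : DifferentiableOn ℂ f (unitBall n)) (hf2 : MemLp f 2 (ballMeasure n)) :
    ofFun f hf hf2 ∈ principalSubmodule p ↔ ∀ ε : ℝ≥0∞, 0 < ε →
      ∃ q : MvPolynomial (Fin n) ℂ, eLpNorm (f - polyFun (p * q)) 2 (ballMeasure n) < ε := by
  have hdist : ∀ q : MvPolynomial (Fin n) ℂ,
      edist (ofFun f hf hf2) (ofPoly n q) = eLpNorm (f - polyFun q) 2 (ballMeasure n) := fun q =>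
    Lp.edist_toLp_toLp f (polyFun q) hf2 (memLp_polyFun q)
  rw [principalSubmodule, ← SetLike.mem_coe, Submodule.topologicalClosure_coe,
    EMetric.mem_closure_iff]
  refine forall₂_congr fun ε _ => ⟨?_, ?_⟩
  · rintro ⟨_, ⟨P, hP, rfl⟩, h⟩
    obtain ⟨q, rfl⟩ := Ideal.mem_span_singleton.1 (show P ∈ Ideal.span {p} from hP)
    exact ⟨q, by rwa [hdist] at h⟩
  · rintro ⟨q, hq⟩
    exact ⟨ofPoly n (p * q), ⟨p * q, Ideal.mul_mem_right q _ (Ideal.mem_span_singleton_self p), rfl⟩,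
      by rwa [hdist]⟩

/-! ### Elements of the principal submodule are divisible by the polynomial -/

theorem polynomial_eval_aeval {R σ : Type*} [CommSemiring R] (P : σ → Polynomial R)
    (p : MvPolynomial σ R) (ζ : R) :
    (MvPolynomial.aeval P p).eval ζ = MvPolynomial.eval (fun i => (P i).eval ζ) p := by
  rw [← Polynomial.coe_evalRingHom, MvPolynomial.map_aeval, MvPolynomial.coe_eval₂Hom]
  change MvPolynomial.eval₂ ((Polynomial.evalRingHom ζ).comp Polynomial.C) _ p =
    MvPolynomial.eval₂ (RingHom.id R) _ p
  congr 1
  ext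
  simp

/-- The restriction of a polynomial to a complex line is a polynomial of no larger degree. -/
theorem exists_slice_polynomial {n : ℕ} (p : MvPolynomial (Fin n) ℂ) (z v : Cn n) :
    ∃ P : Polynomial ℂ, P.natDegree ≤ p.totalDegree ∧
      ∀ ζ : ℂ, P.eval ζ = polyFun p (z + ζ • v) := by
  refine ⟨MvPolynomial.aeval
    (fun i => Polynomial.C (z i) + Polynomial.C (v i) * Polynomial.X) p, ?_, fun ζ => ?_⟩
  · refine (MvPolynomial.aeval_natDegree_le (n := 1) p le_rfl _ fun i => ?_).trans_eq
      (mul_one _)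
    compute_degree
  · rw [polynomial_eval_aeval]
    simp [polyFun, mul_comm ζ]

/-- In every neighborhood of a point there is a circle, centered at the point and contained in a
complex line, on which a given nonzero polynomial does not vanish. For `n = 0` it is a single point. -/
theorem exists_circle_ne_zero {n : ℕ} {p : MvPolynomial (Fin n) ℂ} (hp : p ≠ 0) {U : Set (Cn n)}
    (hU : IsOpen U) {z : Cn n} (hz : z ∈ U) :
    ∃ e : Cn n, ∀ θ : ℝ, z + circleMap 0 1 θ • e ∈ U ∧ polyFun p (z + circleMap 0 1 θ • e) ≠ 0 := by
  obtain ⟨w, hw⟩ : ∃ w : Cn n, polyFun p w ≠ 0 := by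
    by_contra! h
    refine hp (MvPolynomial.funext fun x => ?_)
    simpa [polyFun] using h (WithLp.toLp 2 x)
  obtain ⟨P, -, hP⟩ := exists_slice_polynomial p z (w - z)
  have hP0 : P ≠ 0 := by
    rintro rfl
    have := hP 1
    simp at this
    exact hw this.symm
  have hmem : ∀ᶠ ζ : ℂ in 𝓝 0, z + ζ • (w - z) ∈ U :=
    (by fun_prop : Continuous fun ζ : ℂ => z + ζ • (w - z)).continuousAt.eventually_mem
      (hU.mem_nhds (by simpa using hz))
  have hroot : ∀ᶠ ζ : ℂ in 𝓝[≠] 0, P.eval ζ ≠ 0 := by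
    have hfin : {ζ : ℂ | P.eval ζ = 0}.Finite :=
      (P.roots.toFinset.finite_toSet).subset fun ζ hζ => by simpa [hP0] using hζ
    exact nhdsNE_le_cofinite 0 hfin.compl_mem_cofinite
  obtain ⟨δ, hδ, hball⟩ := Metric.eventually_nhds_iff_ball.1
    (hmem.and (eventually_nhdsWithin_iff.1 hroot))
  refine ⟨((δ / 2 : ℝ) : ℂ) • (w - z), fun θ => ?_⟩
  have hnorm : ‖circleMap 0 1 θ * ((δ / 2 : ℝ) : ℂ)‖ = δ / 2 := by
    rw [norm_mul, Complex.norm_real, Real.norm_of_nonneg (by positivity)]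
    simp
  have hne : circleMap 0 1 θ * ((δ / 2 : ℝ) : ℂ) ≠ 0 :=
    norm_ne_zero_iff.1 (by rw [hnorm]; positivity)
  obtain ⟨h1, h2⟩ := hball (circleMap 0 1 θ * ((δ / 2 : ℝ) : ℂ))
    (by rw [mem_ball_zero_iff, hnorm]; linarith)
  rw [smul_smul]
  exact ⟨h1, by rw [← hP]; exact h2 hne⟩

/-- If `p * q k` converges locally uniformly to a holomorphic `f`, then near each point, zeros of `p`
included, `q k` converges to a holomorphic function: the mean of `f / p` over a circle that avoids
the zeros of `p`. -/
theorem exists_tendsto_differentiableAt {n : ℕ} {p : MvPolynomial (Fin n) ℂ} (hp : p ≠ 0)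
    {U : Set (Cn n)} (hU : IsOpen U) {f : Cn n → ℂ} (hf : DifferentiableOn ℂ f U)
    {q : ℕ → MvPolynomial (Fin n) ℂ}
    (hlim : ∀ K, IsCompact K → K ⊆ U →
      TendstoUniformlyOn (fun k => polyFun (p * q k)) f atTop K) {z : Cn n} (hz : z ∈ U) :
    ∃ h : Cn n → ℂ, DifferentiableAt ℂ h z ∧
      ∀ᶠ w in 𝓝 z, Tendsto (fun k => polyFun (q k) w) atTop (𝓝 (h w)) := by
  obtain ⟨e, he⟩ := exists_circle_ne_zero hp hU hz
  set W : Set (Cn n) := U ∩ {w | polyFun p w ≠ 0} with hW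
  have hpd := differentiable_polyFun p
  have hWo : IsOpen W := hU.inter (isOpen_ne_fun hpd.continuous continuous_const)
  have hcirc : IsCompact (Set.range fun θ : ℝ => z + circleMap 0 1 θ • e) := by
    have : (Set.range fun θ : ℝ => z + circleMap 0 1 θ • e) =
        (fun ζ : ℂ => z + ζ • e) '' sphere 0 |1| := by
      rw [← range_circleMap, ← Set.range_comp]
      rfl
    rw [this]
    exact (isCompact_sphere _ _).image (by fun_prop)
  obtain ⟨s, hs0, hs⟩ := hcirc.exists_thickening_subset_open hWo (by rintro _ ⟨θ, rfl⟩; exact he θ)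
  have hmem : ∀ w ∈ ball z s, ∀ θ : ℝ, w + circleMap 0 1 θ • e ∈ W := by
    intro w hw θ
    refine hs (mem_thickening_iff.2 ⟨_, ⟨θ, rfl⟩, ?_⟩)
    simpa using hw
  have hdiv : DifferentiableOn ℂ (fun w => (polyFun p w)⁻¹ * f w) W :=
    (hpd.differentiableOn.inv fun w hw => hw.2).mul (hf.mono Set.inter_subset_left)
  refine ⟨fun w => ∫ θ in (0 : ℝ)..2 * Real.pi, ((2 * Real.pi : ℝ) : ℂ)⁻¹ *
    ((polyFun p ((1 : ℂ) • w + circleMap 0 1 θ • e))⁻¹ * f ((1 : ℂ) • w + circleMap 0 1 θ • e)),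
    ?_, ?_⟩
  · exact (differentiableOn_integral_comp hWo isOpen_ball hdiv continuous_const continuous_const
      (by fun_prop) (fun w hw θ => by simpa using hmem w hw θ) _ _).differentiableAt
      (ball_mem_nhds z hs0)
  filter_upwards [ball_mem_nhds z hs0] with w hw
  simp only [one_smul]
  have hline : Continuous fun θ : ℝ => w + circleMap 0 1 θ • e := by fun_prop
  have hmean : ∀ k, polyFun (q k) w = ∫ θ in (0 : ℝ)..2 * Real.pi, ((2 * Real.pi : ℝ) : ℂ)⁻¹ *
      ((polyFun p (w + circleMap 0 1 θ • e))⁻¹ * polyFun (p * q k) (w + circleMap 0 1 θ • e)) := by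
    intro k
    have hd : Differentiable ℂ fun ζ : ℂ => polyFun (q k) (w + ζ • e) :=
      (differentiable_polyFun (q k)).comp (by fun_prop)
    have havg := (hd.diffContOnCl (s := ball 0 |1|)).circleAverage
    rw [Real.circleAverage_def, zero_smul, add_zero] at havg
    rw [← havg, intervalIntegral.integral_const_mul, Complex.real_smul, Complex.ofReal_inv]
    congr 1
    refine intervalIntegral.integral_congr fun θ _ => ?_
    have := (hmem w hw θ).2
    simp only [polyFun, map_mul] at this ⊢
    rw [inv_mul_cancel_left₀ this]
  simp only [hmean]
  have hK : IsCompact ((fun θ : ℝ => w + circleMap 0 1 θ • e) '' Set.uIcc 0 (2 * Real.pi)) :=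
    isCompact_uIcc.image hline
  have hKU : (fun θ : ℝ => w + circleMap 0 1 θ • e) '' Set.uIcc 0 (2 * Real.pi) ⊆ U := by
    rintro _ ⟨θ, -, rfl⟩
    exact (hmem w hw θ).1
  have hinv : Continuous fun θ : ℝ => (polyFun p (w + circleMap 0 1 θ • e))⁻¹ :=
    (hpd.continuous.comp hline).inv₀ fun θ => (hmem w hw θ).2
  obtain ⟨C, hC⟩ := isCompact_uIcc.exists_bound_of_continuousOn (s := Set.uIcc 0 (2 * Real.pi))
    hinv.continuousOn
  simp only [intervalIntegral.integral_const_mul]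
  refine Tendsto.const_mul _ ?_
  refine TendstoUniformlyOn.tendsto_intervalIntegral_of_continuousOn (.of_forall fun k =>
    (hinv.mul ((differentiable_polyFun _).continuous.comp hline)).continuousOn) ?_
  rw [Metric.tendstoUniformlyOn_iff]
  intro ε hε
  have hC1 : 0 < |C| + 1 := by positivity
  filter_upwards [Metric.tendstoUniformlyOn_iff.1 (hlim _ hK hKU) (ε / (|C| + 1)) (by positivity)]
    with k hk θ hθ
  have h1 := hk _ ⟨θ, hθ, rfl⟩
  rw [dist_eq_norm] at h1 ⊢
  rw [← mul_sub, norm_mul]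
  calc _ ≤ (|C| + 1) *
          ‖f (w + circleMap 0 1 θ • e) - polyFun (p * q k) (w + circleMap 0 1 θ • e)‖ := by
        gcongr
        exact (hC θ hθ).trans ((le_abs_self C).trans (by linarith))
    _ < (|C| + 1) * (ε / (|C| + 1)) := by gcongr
    _ = ε := mul_div_cancel₀ ε hC1.ne'

theorem exists_holomorphic_quotient {n : ℕ} {p : MvPolynomial (Fin n) ℂ} {f : Cn n → ℂ}
    (hf : DifferentiableOn ℂ f (unitBall n)) (hf2 : MemLp f 2 (ballMeasure n))
    (hmem : ofFun f hf hf2 ∈ principalSubmodule p) :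
    ∃ h : Cn n → ℂ, DifferentiableOn ℂ h (unitBall n) ∧
      ∀ z ∈ unitBall n, f z = polyFun p z * h z := by
  obtain ⟨u, -, hu0, hu⟩ := exists_seq_strictAnti_tendsto' (zero_lt_one' ℝ≥0∞)
  choose q hq using fun k => (mem_principalSubmodule_iff p hf hf2).1 hmem (u k) (hu0 k).1
  have hL2 : Tendsto (fun k => eLpNorm (f - polyFun (p * q k)) 2 (ballMeasure n)) atTop (𝓝 0) := by
    refine tendsto_of_tendsto_of_tendsto_of_le_of_le tendsto_const_nhds hu (fun k => ?_)
      fun k => (hq k).le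
    simp
  have hunif : ∀ K, IsCompact K → K ⊆ unitBall n →
      TendstoUniformlyOn (fun k => polyFun (p * q k)) f atTop K := fun K hK hKB =>
    tendstoUniformlyOn_of_tendsto_eLpNorm hf
      (fun k => (differentiable_polyFun (p * q k)).differentiableOn) hL2 hK hKB
  have hpt : ∀ z ∈ unitBall n, Tendsto (fun k => polyFun (p * q k) z) atTop (𝓝 (f z)) :=
    fun z hz => (hunif {z} isCompact_singleton (by simpa using hz)).tendsto_at
      (Set.mem_singleton z)
  rcases eq_or_ne p 0 with rfl | hp
  · refine ⟨0, differentiableOn_const 0, fun z hz => ?_⟩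
    have := hpt z hz
    simp only [zero_mul, polyFun, map_zero] at this
    simpa using tendsto_nhds_unique this tendsto_const_nhds
  have hloc : ∀ z ∈ unitBall n, ∃ h : Cn n → ℂ, DifferentiableAt ℂ h z ∧
      ∀ᶠ w in 𝓝 z, Tendsto (fun k => polyFun (q k) w) atTop (𝓝 (h w)) := fun z hz =>
    exists_tendsto_differentiableAt hp isOpen_ball hf hunif hz
  choose! h hhd hh using hloc
  -- the local limits agree, being limits of the same sequence
  refine ⟨fun z => h z z, fun z hz => ?_, fun z hz => ?_⟩
  · refine ((hhd z hz).congr_of_eventuallyEq ?_).differentiableWithinAt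
    filter_upwards [hh z hz, isOpen_ball.mem_nhds hz] with w hw hwB
    exact tendsto_nhds_unique (hh w hwB).self_of_nhds hw
  · refine tendsto_nhds_unique (hpt z hz) ?_
    have := (hh z hz).self_of_nhds.const_mul (polyFun p z)
    simpa [polyFun] using this

/-! ### Divisible functions lie in the principal submodule -/

theorem measurableSet_unitBall (n : ℕ) : MeasurableSet (unitBall n) := measurableSet_ball

theorem smul_mem_unitBall {n : ℕ} {z : Cn n} (hz : z ∈ unitBall n) {c : ℂ} (hc : ‖c‖ ≤ 1) :
    c • z ∈ unitBall n := by
  rw [unitBall, mem_ball_zero_iff] at *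
  rw [norm_smul]
  exact (mul_le_of_le_one_left (norm_nonneg z) hc).trans_lt hz

theorem norm_ofReal_le_one {r : ℝ} (hr0 : 0 ≤ r) (hr1 : r ≤ 1) : ‖(r : ℂ)‖ ≤ 1 := by
  rwa [Complex.norm_real, Real.norm_of_nonneg hr0]

/-- The one-variable dilation inequality on the slice through `z`. The constant does not depend on
`z` or `r`. -/
theorem integral_circle_dilate_le {n : ℕ} (p : MvPolynomial (Fin n) ℂ) {h : Cn n → ℂ}
    (hh : DifferentiableOn ℂ h (unitBall n)) {z : Cn n} (hz : z ∈ unitBall n) {r : ℝ}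
    (hr0 : 0 ≤ r) (hr1 : r ≤ 1) :
    ∫ θ in (0 : ℝ)..2 * Real.pi,
        ‖polyFun p (circleMap 0 1 θ • z) * h ((r : ℂ) • circleMap 0 1 θ • z)‖ ^ 2 ≤
      4 ^ p.totalDegree * ∫ θ in (0 : ℝ)..2 * Real.pi,
        ‖polyFun p (circleMap 0 1 θ • z) * h (circleMap 0 1 θ • z)‖ ^ 2 := by
  obtain ⟨P, hPdeg, hP⟩ := exists_slice_polynomial p 0 z
  have hz1 : ‖z‖ < 1 := by simpa [unitBall] using hz
  have hz0 := norm_nonneg z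
  -- the slice function `ζ ↦ h (ζ • z)` is holomorphic beyond the closed unit disc
  have hR : 1 < 2 / (1 + ‖z‖) := by rw [lt_div_iff₀ (by linarith)]; linarith
  have hF : DifferentiableOn ℂ (fun ζ : ℂ => h (ζ • z)) (ball 0 (2 / (1 + ‖z‖))) := by
    intro ζ hζ
    refine (differentiableAt_slice isOpen_ball hh ?_).differentiableWithinAt
    rw [mem_ball_zero_iff] at hζ ⊢
    rw [norm_smul]
    calc ‖ζ‖ * ‖z‖ ≤ 2 / (1 + ‖z‖) * ‖z‖ := by gcongr
      _ < 1 := by rw [div_mul_eq_mul_div, div_lt_one (by linarith)]; linarith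
  have := integral_circle_poly_mul_le hPdeg hR hF hr0 hr1
  simpa only [hP, zero_add, mul_smul] using this

theorem continuous_circle_dilate {n : ℕ} {h : Cn n → ℂ}
    (hh : DifferentiableOn ℂ h (unitBall n)) {z : Cn n} (hz : z ∈ unitBall n) {r : ℝ}
    (hr0 : 0 ≤ r) (hr1 : r ≤ 1) :
    Continuous fun θ : ℝ => h ((r : ℂ) • circleMap 0 1 θ • z) :=
  hh.continuousOn.comp_continuous (by fun_prop) fun θ =>
    smul_mem_unitBall (smul_mem_unitBall hz (by simp)) (norm_ofReal_le_one hr0 hr1)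

theorem integral_circle_dilate_sub_le {n : ℕ} (p : MvPolynomial (Fin n) ℂ) {h : Cn n → ℂ}
    (hh : DifferentiableOn ℂ h (unitBall n)) {z : Cn n} (hz : z ∈ unitBall n) {r : ℝ}
    (hr0 : 0 ≤ r) (hr1 : r ≤ 1) :
    ∫ θ in (0 : ℝ)..2 * Real.pi, ‖polyFun p (circleMap 0 1 θ • z) *
        (h ((r : ℂ) • circleMap 0 1 θ • z) - h (circleMap 0 1 θ • z))‖ ^ 2 ≤
      2 * (4 ^ p.totalDegree + 1) * ∫ θ in (0 : ℝ)..2 * Real.pi,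
        ‖polyFun p (circleMap 0 1 θ • z) * h (circleMap 0 1 θ • z)‖ ^ 2 := by
  have hpc : Continuous fun θ : ℝ => polyFun p (circleMap 0 1 θ • z) :=
    (differentiable_polyFun p).continuous.comp (by fun_prop)
  have h1c : Continuous fun θ : ℝ => h (circleMap 0 1 θ • z) := by
    simpa using continuous_circle_dilate hh hz zero_le_one le_rfl
  have hrc := continuous_circle_dilate hh hz hr0 hr1
  have hA := ((hpc.mul hrc).norm.pow 2).intervalIntegrable (μ := volume) 0 (2 * Real.pi)
  have hB := ((hpc.mul h1c).norm.pow 2).intervalIntegrable (μ := volume) 0 (2 * Real.pi)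
  have hC := ((hpc.mul (hrc.sub h1c)).norm.pow 2).intervalIntegrable (μ := volume) 0 (2 * Real.pi)
  have hslice := integral_circle_dilate_le p hh hz hr0 hr1
  calc _ ≤ ∫ θ in (0 : ℝ)..2 * Real.pi,
        (2 * ‖polyFun p (circleMap 0 1 θ • z) * h ((r : ℂ) • circleMap 0 1 θ • z)‖ ^ 2 +
          2 * ‖polyFun p (circleMap 0 1 θ • z) * h (circleMap 0 1 θ • z)‖ ^ 2) := by
        refine intervalIntegral.integral_mono (by positivity) hC
          ((hA.const_mul 2).add (hB.const_mul 2)) fun θ => ?_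
        have h1 := norm_sub_le
          (polyFun p (circleMap 0 1 θ • z) * h ((r : ℂ) • circleMap 0 1 θ • z))
          (polyFun p (circleMap 0 1 θ • z) * h (circleMap 0 1 θ • z))
        rw [← mul_sub] at h1
        refine (pow_le_pow_left₀ (norm_nonneg _) h1 2).trans ?_
        nlinarith [sq_nonneg (‖polyFun p (circleMap 0 1 θ • z) *
          h ((r : ℂ) • circleMap 0 1 θ • z)‖ -
          ‖polyFun p (circleMap 0 1 θ • z) * h (circleMap 0 1 θ • z)‖)]
    _ = 2 * (∫ θ in (0 : ℝ)..2 * Real.pi,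
          ‖polyFun p (circleMap 0 1 θ • z) * h ((r : ℂ) • circleMap 0 1 θ • z)‖ ^ 2) +
        2 * ∫ θ in (0 : ℝ)..2 * Real.pi,
          ‖polyFun p (circleMap 0 1 θ • z) * h (circleMap 0 1 θ • z)‖ ^ 2 := by
        rw [← intervalIntegral.integral_const_mul, ← intervalIntegral.integral_const_mul]
        exact intervalIntegral.integral_add (hA.const_mul 2) (hB.const_mul 2)
    _ ≤ _ := by linarith

theorem tendsto_integral_circle_dilate_sub {n : ℕ} (p : MvPolynomial (Fin n) ℂ) {h : Cn n → ℂ}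
    (hh : DifferentiableOn ℂ h (unitBall n)) {z : Cn n} (hz : z ∈ unitBall n) {r : ℕ → ℝ}
    (hr : ∀ k, r k ∈ Set.Ioo 0 1) (hlim : Tendsto r atTop (𝓝 1)) :
    Tendsto (fun k => ∫ θ in (0 : ℝ)..2 * Real.pi, ‖polyFun p (circleMap 0 1 θ • z) *
      (h ((r k : ℂ) • circleMap 0 1 θ • z) - h (circleMap 0 1 θ • z))‖ ^ 2) atTop (𝓝 0) := by
  have hpc : Continuous fun θ : ℝ => polyFun p (circleMap 0 1 θ • z) :=
    (differentiable_polyFun p).continuous.comp (by fun_prop)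
  have h1c : Continuous fun θ : ℝ => h (circleMap 0 1 θ • z) := by
    simpa using continuous_circle_dilate hh hz zero_le_one le_rfl
  have hsub : closedBall (0 : Cn n) ‖z‖ ⊆ unitBall n :=
    closedBall_subset_ball (by simpa [unitBall] using hz)
  obtain ⟨M, hM⟩ := (isCompact_closedBall (0 : Cn n) ‖z‖).exists_bound_of_continuousOn
    (hh.continuousOn.mono hsub)
  obtain ⟨C, hC⟩ := (isCompact_closedBall (0 : Cn n) ‖z‖).exists_bound_of_continuousOn
    (differentiable_polyFun p).continuous.continuousOn
  have hmem : ∀ θ : ℝ, circleMap 0 1 θ • z ∈ closedBall (0 : Cn n) ‖z‖ := fun θ => by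
    simp [norm_smul]
  have hmemr : ∀ k, ∀ θ : ℝ, (r k : ℂ) • circleMap 0 1 θ • z ∈ closedBall (0 : Cn n) ‖z‖ := by
    intro k θ
    rw [mem_closedBall_zero_iff, norm_smul, norm_smul]
    simpa using mul_le_of_le_one_left (norm_nonneg z)
      (norm_ofReal_le_one (hr k).1.le (hr k).2.le)
  rw [show 𝓝 (0 : ℝ) = 𝓝 (∫ _ in (0 : ℝ)..2 * Real.pi, (0 : ℝ)) by simp]
  refine intervalIntegral.tendsto_integral_filter_of_dominated_convergence
    (fun _ => (C * (M + M)) ^ 2) (.of_forall fun k => ?_)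
    (.of_forall fun k => .of_forall fun θ _ => ?_)
    intervalIntegrable_const (.of_forall fun θ _ => ?_)
  · exact ((hpc.mul ((continuous_circle_dilate hh hz (hr k).1.le (hr k).2.le).sub
      h1c)).norm.pow 2).aestronglyMeasurable
  · rw [norm_pow, norm_norm, norm_mul]
    have h1 := hC _ (hmem θ)
    have h2 := norm_sub_le_of_le (hM _ (hmemr k θ)) (hM _ (hmem θ))
    gcongr
    exact (norm_nonneg _).trans h1
  · have hat : ContinuousAt h (circleMap 0 1 θ • z) :=
      hh.continuousOn.continuousAt (isOpen_ball.mem_nhds (hsub (hmem θ)))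
    have hl : Tendsto (fun k => (r k : ℂ) • circleMap 0 1 θ • z) atTop
        (𝓝 (circleMap 0 1 θ • z)) := by
      have := (Complex.continuous_ofReal.tendsto 1 |>.comp hlim).smul_const (circleMap 0 1 θ • z)
      simpa [Function.comp_def] using this
    have := (((hat.tendsto.comp hl).sub_const (h (circleMap 0 1 θ • z))).const_mul
      (polyFun p (circleMap 0 1 θ • z))).norm.pow 2
    simpa [Function.comp_def] using this

theorem lintegral_unitBall_enorm_sq {n : ℕ} (g : Cn n → ℂ) :
    ∫⁻ z in unitBall n, ‖g z‖ₑ ^ 2 = volume (unitBall n) * eLpNorm g 2 (ballMeasure n) ^ 2 := by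
  have h := eLpNorm_nnreal_pow_eq_lintegral (μ := ballMeasure n) (f := g) (p := 2) two_ne_zero
  simp only [NNReal.coe_ofNat, ENNReal.rpow_ofNat, ENNReal.coe_ofNat] at h
  rw [h, ballMeasure, lintegral_smul_measure, smul_eq_mul, ← mul_assoc,
    ENNReal.mul_inv_cancel (volume_unitBall_ne_zero n) (volume_unitBall_ne_top n), one_mul]

theorem lintegral_circle_indicator {n : ℕ} {g : Cn n → ℂ} (hg : ContinuousOn g (unitBall n))
    {z : Cn n} (hz : z ∈ unitBall n) :
    ∫⁻ θ in Set.Ioc 0 (2 * Real.pi),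
        (unitBall n).indicator (fun w => ‖g w‖ₑ ^ 2) (circleMap 0 1 θ • z) =
      ENNReal.ofReal (∫ θ in (0 : ℝ)..2 * Real.pi, ‖g (circleMap 0 1 θ • z)‖ ^ 2) := by
  have hmem : ∀ θ : ℝ, circleMap 0 1 θ • z ∈ unitBall n := fun θ =>
    smul_mem_unitBall hz (by simp)
  have hc : Continuous fun θ : ℝ => ‖g (circleMap 0 1 θ • z)‖ ^ 2 :=
    (hg.comp_continuous (by fun_prop) hmem).norm.pow 2
  rw [intervalIntegral.integral_of_le (by positivity), ofReal_integral_eq_lintegral_ofReal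
    ((hc.intervalIntegrable 0 (2 * Real.pi)).1) (.of_forall fun θ => by positivity)]
  refine lintegral_congr fun θ => ?_
  rw [Set.indicator_of_mem (hmem θ), ENNReal.ofReal_pow (norm_nonneg _), ofReal_norm]

/-- The dilations `h_r` satisfy `p h_r → p h` in the Bergman space. Dominated convergence is applied
to the circle means of `|p h_r - p h|²` and not to this function itself, because only the circle
means have an integrable bound that is uniform in `r`. -/
theorem tendsto_eLpNorm_dilate_sub {n : ℕ} (p : MvPolynomial (Fin n) ℂ) {h : Cn n → ℂ}
    (hh : DifferentiableOn ℂ h (unitBall n))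
    (hph : eLpNorm (fun z => polyFun p z * h z) 2 (ballMeasure n) ≠ ∞) {r : ℕ → ℝ}
    (hr : ∀ k, r k ∈ Set.Ioo 0 1) (hlim : Tendsto r atTop (𝓝 1)) :
    Tendsto (fun k => eLpNorm (fun z => polyFun p z * (h ((r k : ℂ) • z) - h z)) 2
      (ballMeasure n)) atTop (𝓝 0) := by
  have hpi0 : ENNReal.ofReal (2 * Real.pi) ≠ 0 := by
    rw [Ne, ENNReal.ofReal_eq_zero, not_le]; positivity
  have hdil : ∀ k, ContinuousOn (fun z => h ((r k : ℂ) • z)) (unitBall n) := fun k =>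
    hh.continuousOn.comp (by fun_prop) fun z hz =>
      smul_mem_unitBall hz (norm_ofReal_le_one (hr k).1.le (hr k).2.le)
  have hpc := (differentiable_polyFun p).continuous.continuousOn (s := unitBall n)
  have hgc : ContinuousOn (fun z => polyFun p z * h z) (unitBall n) := hpc.mul hh.continuousOn
  have hdc : ∀ k, ContinuousOn (fun z => polyFun p z * (h ((r k : ℂ) • z) - h z)) (unitBall n) :=
    fun k => hpc.mul ((hdil k).sub hh.continuousOn)
  have hind : ∀ {g : Cn n → ℂ}, ContinuousOn g (unitBall n) →
      Measurable ((unitBall n).indicator fun w => ‖g w‖ₑ ^ 2) := fun hg =>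
    measurable_indicator_of_continuousOn isOpen_ball (by fun_prop)
  -- the circle means are integrated over `ℂⁿ`, with values of `g` outside the ball cut off
  have hrot : ∀ {g : Cn n → ℂ}, ContinuousOn g (unitBall n) →
      ∫⁻ z, ∫⁻ θ in Set.Ioc 0 (2 * Real.pi),
          (unitBall n).indicator (fun w => ‖g w‖ₑ ^ 2) (circleMap 0 1 θ • z) =
        ENNReal.ofReal (2 * Real.pi) *
          (volume (unitBall n) * eLpNorm g 2 (ballMeasure n) ^ 2) := fun {g} hg => by
    rw [lintegral_lintegral_rotate (hind hg), ← lintegral_unitBall_enorm_sq,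
      lintegral_indicator (measurableSet_unitBall n)]
  have hout : ∀ (g : Cn n → ℂ) {z : Cn n}, z ∉ unitBall n → ∫⁻ θ in Set.Ioc 0 (2 * Real.pi),
      (unitBall n).indicator (fun w => ‖g w‖ₑ ^ 2) (circleMap 0 1 θ • z) = 0 := by
    intro g z hz
    refine lintegral_eq_zero_of_ae_eq_zero (.of_forall fun θ => ?_)
    refine Set.indicator_of_notMem (fun hθ => hz ?_) _
    simpa [unitBall, norm_smul] using hθ
  have hdom := tendsto_lintegral_of_dominated_convergence (μ := (volume : Measure (Cn n)))
    (F := fun k z => ∫⁻ θ in Set.Ioc 0 (2 * Real.pi), (unitBall n).indicator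
      (fun w => ‖polyFun p w * (h ((r k : ℂ) • w) - h w)‖ₑ ^ 2) (circleMap 0 1 θ • z))
    (f := fun _ => 0)
    (fun z => ENNReal.ofReal (2 * (4 ^ p.totalDegree + 1)) * ∫⁻ θ in Set.Ioc 0 (2 * Real.pi),
      (unitBall n).indicator (fun w => ‖polyFun p w * h w‖ₑ ^ 2) (circleMap 0 1 θ • z))
    (fun k => ?_) (fun k => .of_forall fun z => ?_) ?_ (.of_forall fun z => ?_)
  · simp only [hrot (hdc _), lintegral_zero] at hdom
    have h2 : Tendsto (fun k => eLpNorm (fun z => polyFun p z * (h ((r k : ℂ) • z) - h z)) 2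
        (ballMeasure n) ^ 2) atTop (𝓝 0) := by
      have := ENNReal.Tendsto.const_mul (a := (ENNReal.ofReal (2 * Real.pi) *
        volume (unitBall n))⁻¹) hdom (.inr (ENNReal.inv_ne_top.2
          (mul_ne_zero hpi0 (volume_unitBall_ne_zero n))))
      rw [mul_zero] at this
      refine this.congr fun k => ?_
      rw [← mul_assoc (ENNReal.ofReal _), ← mul_assoc, ENNReal.inv_mul_cancel
        (mul_ne_zero hpi0 (volume_unitBall_ne_zero n))
        (ENNReal.mul_ne_top ENNReal.ofReal_ne_top (volume_unitBall_ne_top n)), one_mul]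
    have h3 := h2.ennrpow_const (1 / 2)
    rw [ENNReal.zero_rpow_of_pos (by norm_num)] at h3
    refine h3.congr fun k => ?_
    rw [← ENNReal.rpow_natCast, ← ENNReal.rpow_mul]
    norm_num
  · refine Measurable.lintegral_prod_right' (f := fun q : Cn n × ℝ => (unitBall n).indicator
      (fun w => ‖polyFun p w * (h ((r k : ℂ) • w) - h w)‖ₑ ^ 2) (circleMap 0 1 q.2 • q.1))
      ((hind (hdc k)).comp (Continuous.measurable ?_))
    exact ((continuous_circleMap 0 1).comp continuous_snd).smul continuous_fst
  · by_cases hz : z ∈ unitBall n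
    · simp only [lintegral_circle_indicator (hdc k) hz, lintegral_circle_indicator hgc hz]
      rw [← ENNReal.ofReal_mul (by positivity)]
      exact ENNReal.ofReal_le_ofReal
        (integral_circle_dilate_sub_le p hh hz (hr k).1.le (hr k).2.le)
    · exact (hout _ hz).trans_le zero_le
  · rw [lintegral_const_mul' _ _ ENNReal.ofReal_ne_top, hrot hgc]
    exact ENNReal.mul_ne_top ENNReal.ofReal_ne_top (ENNReal.mul_ne_top ENNReal.ofReal_ne_top
      (ENNReal.mul_ne_top (volume_unitBall_ne_top n) (ENNReal.pow_ne_top hph)))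
  · by_cases hz : z ∈ unitBall n
    · simp only [lintegral_circle_indicator (hdc _) hz]
      simpa using ENNReal.tendsto_ofReal (tendsto_integral_circle_dilate_sub p hh hz hr hlim)
    · simp only [hout _ hz]
      exact tendsto_const_nhds

/-- The functions `p h_r` with `r < 1` lie in the closure of the ideal generated by `p`. -/
theorem exists_eLpNorm_dilate_sub_lt {n : ℕ} (p : MvPolynomial (Fin n) ℂ) {h : Cn n → ℂ}
    (hh : DifferentiableOn ℂ h (unitBall n)) {r : ℝ} (hr0 : 0 < r) (hr1 : r < 1) {ε : ℝ≥0∞}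
    (hε : 0 < ε) : ∃ q : MvPolynomial (Fin n) ℂ,
      eLpNorm (fun z => polyFun p z * h ((r : ℂ) • z) - polyFun (p * q) z) 2 (ballMeasure n) < ε := by
  obtain ⟨δ, hδ0, hδ⟩ : ∃ δ : ℝ, 0 < δ ∧ ENNReal.ofReal δ < ε := by
    obtain ⟨δ, hδ0, hδ⟩ := ENNReal.lt_iff_exists_nnreal_btwn.1 hε
    exact ⟨δ, by simpa using hδ0, by simpa using hδ⟩
  obtain ⟨C, hC⟩ := (isCompact_closedBall (0 : Cn n) 1).exists_bound_of_continuousOn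
    (differentiable_polyFun p).continuous.continuousOn
  have hC0 : 0 ≤ C := (norm_nonneg _).trans (hC 0 (mem_closedBall_self zero_le_one))
  obtain ⟨q, hq⟩ := exists_polyFun_approx hh hr0 hr1 (ε := δ / (C + 1)) (by positivity)
  have hdil : ∀ z : Cn n, polyFun (MvPolynomial.bind₁
      (fun i => MvPolynomial.C (r : ℂ) * MvPolynomial.X i) q) z = polyFun q ((r : ℂ) • z) := by
    intro z
    rw [polyFun, MvPolynomial.bind₁, MvPolynomial.map_aeval, MvPolynomial.coe_eval₂Hom]
    have hid : (MvPolynomial.eval fun i => z i).comp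
        (algebraMap ℂ (MvPolynomial (Fin n) ℂ)) = RingHom.id ℂ := by
      ext
      simp
    rw [hid]
    change _ = MvPolynomial.eval₂ (RingHom.id ℂ) (fun i => ((r : ℂ) • z) i) q
    congr 1
    ext i
    simp
  refine ⟨MvPolynomial.bind₁ (fun i => MvPolynomial.C (r : ℂ) * MvPolynomial.X i) q, ?_⟩
  refine (eLpNorm_le_of_ae_bound (C := δ) ?_).trans_lt (by simpa using hδ)
  refine Measure.ae_smul_measure ?_ _
  filter_upwards [ae_restrict_mem isOpen_ball.measurableSet] with z hz
  have hz1 : ‖z‖ < 1 := by simpa [unitBall] using hz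
  have hrz : (r : ℂ) • z ∈ closedBall (0 : Cn n) r := by
    rw [mem_closedBall_zero_iff, norm_smul, Complex.norm_real, Real.norm_of_nonneg hr0.le]
    exact mul_le_of_le_one_right hr0.le hz1.le
  have hmul : polyFun (p * MvPolynomial.bind₁
      (fun i => MvPolynomial.C (r : ℂ) * MvPolynomial.X i) q) z =
      polyFun p z * polyFun q ((r : ℂ) • z) := by
    rw [← hdil]
    simp [polyFun]
  rw [hmul, ← mul_sub, norm_mul]
  calc ‖polyFun p z‖ * ‖h ((r : ℂ) • z) - polyFun q ((r : ℂ) • z)‖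
      ≤ (C + 1) * (δ / (C + 1)) := by
        gcongr
        · exact (hC z (by simpa using hz1.le)).trans (by linarith)
        · exact (hq _ hrz).le
    _ = δ := mul_div_cancel₀ δ (by positivity)

theorem mem_principalSubmodule_of_eq_mul {n : ℕ} {p : MvPolynomial (Fin n) ℂ} {f h : Cn n → ℂ}
    (hf : DifferentiableOn ℂ f (unitBall n)) (hf2 : MemLp f 2 (ballMeasure n))
    (hh : DifferentiableOn ℂ h (unitBall n))
    (hfh : ∀ z ∈ unitBall n, f z = polyFun p z * h z) :
    ofFun f hf hf2 ∈ principalSubmodule p := by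
  have hae : f =ᵐ[ballMeasure n] fun z => polyFun p z * h z := by
    refine Measure.ae_smul_measure ?_ _
    filter_upwards [ae_restrict_mem isOpen_ball.measurableSet] with z hz using hfh z hz
  rw [mem_principalSubmodule_iff]
  intro ε hε
  obtain ⟨r, -, hr, hlim⟩ := exists_seq_strictMono_tendsto' (zero_lt_one' ℝ)
  have hε2 : 0 < ε / 2 := ENNReal.half_pos hε.ne'
  obtain ⟨k, hk⟩ := ((tendsto_eLpNorm_dilate_sub p hh
    (by rw [← eLpNorm_congr_ae hae]; exact hf2.2.ne) hr hlim).eventually_lt_const hε2).exists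
  obtain ⟨q, hq⟩ := exists_eLpNorm_dilate_sub_lt p hh (hr k).1 (hr k).2 hε2
  refine ⟨q, ?_⟩
  have hmeas : ∀ {g : Cn n → ℂ}, ContinuousOn g (unitBall n) →
      AEStronglyMeasurable g (ballMeasure n) := fun hg =>
    (hg.aestronglyMeasurable isOpen_ball.measurableSet).smul_measure _
  have hpc : ∀ p : MvPolynomial (Fin n) ℂ, ContinuousOn (polyFun p) (unitBall n) := fun p =>
    (differentiable_polyFun p).continuous.continuousOn
  have hdil : ContinuousOn (fun z => h ((r k : ℂ) • z)) (unitBall n) :=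
    hh.continuousOn.comp (by fun_prop) fun z hz =>
      smul_mem_unitBall hz (norm_ofReal_le_one (hr k).1.le (hr k).2.le)
  have hsplit : f - polyFun (p * q) =ᵐ[ballMeasure n]
      (fun z => polyFun p z * h ((r k : ℂ) • z) - polyFun (p * q) z) -
        fun z => polyFun p z * (h ((r k : ℂ) • z) - h z) := by
    filter_upwards [hae] with z hz
    simp only [Pi.sub_apply, hz]
    ring
  rw [eLpNorm_congr_ae hsplit]
  calc _ ≤ _ := eLpNorm_sub_le (hmeas (((hpc p).mul hdil).sub (hpc (p * q))))
        (hmeas ((hpc p).mul (hdil.sub hh.continuousOn))) one_le_two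
    _ < ε / 2 + ε / 2 := ENNReal.add_lt_add hq hk
    _ = ε := ENNReal.add_halves ε

end Bergman

theorem corollary4p5 (n : ℕ) (p : MvPolynomial (Fin n) ℂ) (f : Bergman.Cn n → ℂ)
    (hf : DifferentiableOn ℂ f (Bergman.unitBall n))
    (hf2 : MemLp f 2 (Bergman.ballMeasure n)) :
    Bergman.ofFun f hf hf2 ∈ Bergman.principalSubmodule p ↔
      ∃ h : Bergman.Cn n → ℂ, DifferentiableOn ℂ h (Bergman.unitBall n) ∧
        ∀ z ∈ Bergman.unitBall n, f z = Bergman.polyFun p z * h z := by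
  constructor
  · exact Bergman.exists_holomorphic_quotient hf hf2
  · rintro ⟨h, hh, hfh⟩
    exact Bergman.mem_principalSubmodule_of_eq_mul hf hf2 hh hfh
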